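/- Let $k>0$ and $\beta\in\mathbb R$. Write $(a)_n=a(a+1)\cdots(a+n-1)$, let ${}_1F_1$ and ${}_3F_2$ be the usual hypergeometric series, and let $$p_n(x;a,b,c,d)=i^n\,\frac{(a+c)_n(a+d)_n}{n!}\;{}_3F_2\!\left(\left.{-n,\;n+a+b+c+d-1,\;a+ix\atop a+c,\;a+d}\right|1\right)$$ be the continuous Hahn polynomials. On the plane with the origin removed use polar coordinates $r>0$, $\varphi\in[0,2\pi)$ and parabolic coordinates $\xi\ge 0$, $\eta\in\mathbb R$, so that $x=r\cos\varphi=\frac{\xi^2-\eta^2}{2}$ and $y=r\sin\varphi=\xi\eta$. The polar basis of solutions of the Helmholtz equation $\Delta\Psi+k^2\Psi=0$ is $$\Psi_{km}(r,\varphi)=\sqrt k\,J_{|m|}(kr)\,\frac{e^{im\varphi}}{\sqrt{2\pi}},\qquad m\in\mathbb Z,$$ and the even and odd parabolic wave functions are $$\Psi^{(+)}_{k\beta}(\xi,\eta)=\frac{|\Gamma(\frac14+\frac{i\beta}{2k})|^2}{2\sqrt2\,\pi^2}\,e^{-ik\frac{\xi^2+\eta^2}{2}}\,{}_1F_1\!\left(\tfrac14+\tfrac{i\beta}{2k};\tfrac12;ik\xi^2\right){}_1F_1\!\left(\tfrac14-\tfrac{i\beta}{2k};\tfrac12;ik\eta^2\right),$$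 $$\Psi^{(-)}_{k\beta}(\xi,\eta)=\frac{\sqrt2\,k\,|\Gamma(\frac34+\frac{i\beta}{2k})|^2}{\pi^2}\,\xi\eta\,e^{-ik\frac{\xi^2+\eta^2}{2}}\,{}_1F_1\!\left(\tfrac34+\tfrac{i\beta}{2k};\tfrac32;ik\xi^2\right){}_1F_1\!\left(\tfrac34-\tfrac{i\beta}{2k};\tfrac32;ik\eta^2\right).$$ Then for each sign there is exactly one family of coefficients $\mathcal W^{(\pm)}_{k\beta m}$, $m\in\mathbb Z$, independent of the point, such that at every point of the punctured plane $$\Psi^{(\pm)}_{k\beta}(\xi,\eta)=\sum_{m=-\infty}^{\infty}\mathcal W^{(\pm)}_{k\beta m}\,\Psi_{km}(r,\varphi)$$ with an (absolutely) convergent series. For every $m\in\mathbb Z$ these coefficients are $$\mathcal W^{(+)}_{k\beta m}=\frac{(-i)^{|m|}}{2\sqrt{\pi^3k}}\left|\Gamma\!\left(\tfrac14+\tfrac{i\beta}{2k}\right)\right|^2{}_3F_2\!\left(\left.{-|m|,\;|m|,\;\frac14+\frac{i\beta}{2k}\atop \frac12,\;\frac12}\right|1\right)=\frac{(-1)^{|m|}\,|m|!}{2\sqrt{\pi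 k}}\,\frac{|\Gamma(\frac14+\frac{i\beta}{2k})|^2}{\Gamma^2(\frac12+|m|)}\;p_{|m|}\!\left(\tfrac{\beta}{2k};\tfrac14,\tfrac14,\tfrac14,\tfrac14\right),$$ $$\mathcal W^{(-)}_{k\beta m}=2m\,\frac{(-i)^{|m|}}{\sqrt{\pi^3k}}\left|\Gamma\!\left(\tfrac34+\tfrac{i\beta}{2k}\right)\right|^2{}_3F_2\!\left(\left.{1-|m|,\;1+|m|,\;\frac34+\frac{i\beta}{2k}\atop \frac32,\;\frac32}\right|1\right)=i\,\mathrm{sign}(m)\,\frac{(-1)^{|m|}\,|m|!}{2\sqrt{\pi k}}\,\frac{|\Gamma(\frac34+\frac{i\beta}{2k})|^2}{\Gamma^2(\frac12+|m|)}\;p_{|m|-1}\!\left(\tfrac{\beta}{2k};\tfrac34,\tfrac34,\tfrac34,\tfrac34\right).$$ For $m=0$ both expressions for $\mathcal W^{(-)}_{k\beta m}$ are read as $0$, that is, $\mathcal W^{(-)}_{k\beta 0}=0$ (with $\mathrm{sign}(0)=0$). All other ${}_3F_2$ series here terminate. -/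

import Mathlib

noncomputable section

namespace ParabolicPolar

/-- The Pochhammer symbol `(a)_n = a (a + 1) ⋯ (a + n - 1)`. -/
def poch (a : ℂ) (n : ℕ) : ℂ := (ascPochhammer ℂ n).eval a

/-- The confluent hypergeometric function `₁F₁(a; b; z)`. -/
def hyp1F1 (a b z : ℂ) : ℂ :=
  ∑' n : ℕ, poch a n / poch b n * z ^ n / (n.factorial : ℂ)

/-- The generalized hypergeometric series `₃F₂(a₁, a₂, a₃; b₁, b₂ | z)`; it is a finite sum when
one of the upper parameters is a non-positive integer. -/
def hyp3F2 (a₁ a₂ a₃ b₁ b₂ z : ℂ) : ℂ :=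
  ∑' n : ℕ, poch a₁ n * poch a₂ n * poch a₃ n / (poch b₁ n * poch b₂ n) * z ^ n / (n.factorial : ℂ)

/-- The Bessel function of the first kind `J_n(x)` of integer order `n ≥ 0`. -/
def besselJ (n : ℕ) (x : ℝ) : ℝ :=
  ∑' j : ℕ, (-1) ^ j / ((j.factorial : ℝ) * ((j + n).factorial : ℝ)) * (x / 2) ^ (2 * j + n)

/-- The continuous Hahn polynomial `p_n(x; a, b, c, d)`. -/
def continuousHahn (n : ℕ) (x a b c d : ℂ) : ℂ :=
  Complex.I ^ n * (poch (a + c) n * poch (a + d) n / (n.factorial : ℂ)) *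
    hyp3F2 (-(n : ℂ)) (n + a + b + c + d - 1) (a + Complex.I * x) (a + c) (a + d) 1

/-- The polar wave function `Ψ_{km}(r, φ) = √k J_{|m|}(kr) e^{imφ} / √(2π)`. -/
def polarWave (k : ℝ) (m : ℤ) (r φ : ℝ) : ℂ :=
  (√k : ℂ) * (besselJ m.natAbs (k * r) : ℂ) *
    (Complex.exp (Complex.I * m * φ) / (√(2 * Real.pi) : ℂ))

/-- The normalization constant `C⁺_{kβ} = |Γ(1/4 + iβ/(2k))|² / (2 √2 π²)`. -/
def normEven (k β : ℝ) : ℝ :=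
  ‖Complex.Gamma (1 / 4 + Complex.I * β / (2 * k))‖ ^ 2 / (2 * √2 * Real.pi ^ 2)

/-- The normalization constant `C⁻_{kβ} = √2 k |Γ(3/4 + iβ/(2k))|² / π²`. -/
def normOdd (k β : ℝ) : ℝ :=
  √2 * k * ‖Complex.Gamma (3 / 4 + Complex.I * β / (2 * k))‖ ^ 2 / Real.pi ^ 2

/-- The even parabolic wave function `Ψ⁺_{kβ}(ξ, η)`. -/
def parabolicEven (k β ξ η : ℝ) : ℂ :=
  (normEven k β : ℂ) * Complex.exp (-(Complex.I * k * (ξ ^ 2 + η ^ 2) / 2)) *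
    hyp1F1 (1 / 4 + Complex.I * β / (2 * k)) (1 / 2) (Complex.I * k * ξ ^ 2) *
    hyp1F1 (1 / 4 - Complex.I * β / (2 * k)) (1 / 2) (Complex.I * k * η ^ 2)

/-- The odd parabolic wave function `Ψ⁻_{kβ}(ξ, η)`. -/
def parabolicOdd (k β ξ η : ℝ) : ℂ :=
  (normOdd k β : ℂ) * (ξ * η) * Complex.exp (-(Complex.I * k * (ξ ^ 2 + η ^ 2) / 2)) *
    hyp1F1 (3 / 4 + Complex.I * β / (2 * k)) (3 / 2) (Complex.I * k * ξ ^ 2) *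
    hyp1F1 (3 / 4 - Complex.I * β / (2 * k)) (3 / 2) (Complex.I * k * η ^ 2)

/-- `W` is a family of coefficients (independent of the point) of an expansion
`Ψ(ξ, η) = ∑_{m ∈ ℤ} W_m Ψ_{km}(r, φ)` over the polar basis, valid at every point of the
punctured plane. The parabolic coordinates `ξ ≥ 0`, `η ∈ ℝ` and the polar coordinates
`r > 0`, `φ ∈ [0, 2π)` of a point are linked by
`x = (ξ² - η²)/2 = r cos φ`, `y = ξ η = r sin φ`. -/
def IsPolarExpansion (k : ℝ) (Ψ : ℝ → ℝ → ℂ) (W : ℤ → ℂ) : Prop :=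
  ∀ ξ η r φ : ℝ, 0 ≤ ξ → 0 < r → φ ∈ Set.Ico 0 (2 * Real.pi) →
    (ξ ^ 2 - η ^ 2) / 2 = r * Real.cos φ → ξ * η = r * Real.sin φ →
    HasSum (fun m : ℤ => W m * polarWave k m r φ) (Ψ ξ η)

end ParabolicPolar

end

noncomputable section

namespace ParabolicPolar

open Complex Finset MeasureTheory

/-! Both parabolic waves are superpositions of plane waves over a beta weight. Put `u = 1/4 +
iβ/(2k)`, `v = 1/4 - iβ/(2k)` in the even case (3/4 in the odd case), and let `betaMean u v` average
over `t ∈ [0, 1]` with weight `t^(u-1) (1-t)^(v-1)`. The product formula `betaMean_exp_mul_hyp0F1`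
writes a product of two `₁F₁` as a mean of an exponential times a `₀F₁`; comparing coefficients of
`X^p Y^q` reduces it to the Pfaff–Saalschütz sum `sum_saalTerm`. With `cos θ = 1 - 2t` the
exponential becomes `e^{-ikx cos θ}` and the `₀F₁` becomes `cos(ky sin θ)` when `u + v = 1/2`, or
`sin(ky sin θ)/(ky sin θ)` when `u + v = 3/2` (`betaMean_planeWave`).

The Jacobi–Anger series in the directions `φ ± θ` expands this integrand in `J_{|m|}(kr) e^{imφ}`
with weights `cos mθ`, respectively `sin mθ / sin θ`. Averaging termwise leaves beta means of
Chebyshev polynomials in `1 - 2t`. These polynomials are terminating `₂F₁` in `t`, and the mean of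
`t^j` is `(u)_j/(u+v)_j`, so the coefficients are the stated `₃F₂`. The continuous Hahn form is a
rearrangement of constants.

Uniqueness uses only the circle `kr = 1`: there the expansion is an absolutely convergent Fourier
series, and `J_n(1) ≠ 0` for every `n`. -/

/-! ### Pochhammer symbols and the Pfaff–Saalschütz sum. -/

lemma poch_zero (a : ℂ) : poch a 0 = 1 := by simp [poch]

lemma poch_succ (a : ℂ) (n : ℕ) : poch a (n + 1) = poch a n * (a + n) :=
  ascPochhammer_succ_eval n a

lemma poch_eq_prod (a : ℂ) (n : ℕ) : poch a n = ∏ i ∈ range n, (a + i) := by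
  induction n with
  | zero => simp [poch_zero]
  | succ n ih => rw [poch_succ, prod_range_succ, ih]

lemma poch_neg_eq_zero {n j : ℕ} (h : n < j) : poch (-(n : ℂ)) j = 0 :=
  ascPochhammer_eval_neg_coe_nat_of_lt h

/-- Every factor after the first has real part at least 1, so only the factor `c` can make the
product small. Being uniform in `n`, the bound lets the exponential series dominate `₀F₁`. -/
lemma min_one_re_le_norm_poch {c : ℂ} (hc : 0 < c.re) (n : ℕ) : min 1 c.re ≤ ‖poch c n‖ := by
  rcases n with _ | n
  · simp [poch_zero]
  refine (min_le_right _ _).trans ?_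
  induction n with
  | zero => simpa [poch_succ, poch_zero] using re_le_norm c
  | succ n ih =>
    rw [poch_succ, norm_mul]
    have h : 1 ≤ ‖c + ((n + 1 : ℕ) : ℂ)‖ := by
      refine le_trans ?_ (re_le_norm _)
      simp only [add_re, natCast_re]
      push_cast
      have : (0 : ℝ) ≤ n := n.cast_nonneg
      linarith
    nlinarith [norm_nonneg (poch c (n + 1))]

lemma poch_ne_zero {c : ℂ} (hc : 0 < c.re) (n : ℕ) : poch c n ≠ 0 := by
  have h := min_one_re_le_norm_poch hc n
  have : 0 < min 1 c.re := lt_min one_pos hc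
  exact norm_pos_iff.mp (this.trans_le h)

lemma Gamma_add_natCast {a : ℂ} (ha : 0 < a.re) (n : ℕ) :
    Gamma (a + n) = poch a n * Gamma a := by
  induction n with
  | zero => simp [poch_zero]
  | succ n ih =>
    have : a + n ≠ 0 := by
      intro h
      have := congrArg re h
      simp at this
      have : (0 : ℝ) ≤ n := n.cast_nonneg
      linarith
    rw [Nat.cast_succ, ← add_assoc, Gamma_add_one _ this, ih, poch_succ]
    ring

/-- The summand in the Pfaff–Saalschütz sum. -/
def saalTerm (u v : ℂ) (p q j : ℕ) : ℂ :=
  (-1) ^ j * q.choose j * p.descFactorial j * poch u (p + q - j) * poch v j / poch (u + v) j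

lemma saalTerm_zero (u v : ℂ) (p q : ℕ) : saalTerm u v p q 0 = poch u (p + q) := by
  simp [saalTerm, poch_zero]

lemma saalTerm_succ_zero (u v : ℂ) (p q : ℕ) :
    (u + v + q) * saalTerm u v p (q + 1) 0 =
      (u + q) * (u + v + p + q) * saalTerm u v p q 0 + p * v * saalTerm u v p q 0 := by
  simp only [saalTerm_zero, ← add_assoc, poch_succ]
  push_cast
  ring

/-- A creative-telescoping certificate: the defect in the first-order recurrence in `q` is the
difference of `(p - j)(v + j) * saalTerm u v p q j` between `j = i + 1` and `j = i`. -/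
lemma saalTerm_succ_succ {u v : ℂ} (hc : 0 < (u + v).re) (p q i : ℕ) :
    (u + v + q) * saalTerm u v p (q + 1) (i + 1) =
      (u + q) * (u + v + p + q) * saalTerm u v p q (i + 1) +
        ((p - (i + 1 : ℕ)) * (v + (i + 1 : ℕ)) * saalTerm u v p q (i + 1) -
          (p - i) * (v + i) * saalTerm u v p q i) := by
  rcases lt_or_ge i p with hi | hi
  · obtain ⟨r, rfl⟩ : ∃ r, p = i + 1 + r := ⟨p - (i + 1), by omega⟩
    have e1 : i + 1 + r + (q + 1) - (i + 1) = r + q + 1 := by omega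
    have e2 : i + 1 + r + q - (i + 1) = r + q := by omega
    have e3 : i + 1 + r + q - i = r + q + 1 := by omega
    have hd : (((i + 1 + r).descFactorial (i + 1) : ℕ) : ℂ) =
        (r + 1) * ((i + 1 + r).descFactorial i : ℕ) := by
      rw [Nat.descFactorial_succ, show i + 1 + r - i = r + 1 by omega]; push_cast; ring
    have hb : ((i + 1 : ℕ) : ℂ) * q.choose (i + 1) = (q - i) * q.choose i := by
      rcases le_or_gt i q with h | h
      · rw [← Nat.cast_sub h, mul_comm, mul_comm ((q - i : ℕ) : ℂ)]
        exact_mod_cast Nat.choose_succ_right_eq q i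
      · simp [Nat.choose_eq_zero_of_lt h, Nat.choose_eq_zero_of_lt (h.trans (Nat.lt_succ_self i))]
    have h1 := poch_ne_zero hc i
    have h2 := poch_ne_zero hc (i + 1)
    rw [poch_succ] at h2
    have h3 := right_ne_zero_of_mul h2
    simp only [saalTerm, e1, e2, e3, hd, poch_succ, Nat.choose_succ_succ, pow_succ]
    generalize ((i + 1 + r).descFactorial i : ℂ) = P at *
    generalize poch u (r + q) = E
    generalize poch v i = V
    generalize poch (u + v) i = C at *
    push_cast at hb ⊢
    generalize (q.choose i : ℂ) = a at *
    generalize (q.choose (i + 1) : ℂ) = b at *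
    field_simp
    linear_combination (P * E * V * (v + i) * (r + 1) * (u + r + q)) * hb
  · have h0 : p.descFactorial (i + 1) = 0 := Nat.descFactorial_of_lt (by omega)
    rcases hi.eq_or_lt with rfl | hi
    · simp [saalTerm]
    · simp [saalTerm, Nat.descFactorial_of_lt hi]

/-- The Pfaff–Saalschütz summation. -/
lemma sum_saalTerm {u v : ℂ} (hc : 0 < (u + v).re) (p q : ℕ) :
    (∑ j ∈ range (q + 1), saalTerm u v p q j) * (poch (u + v) p * poch (u + v) q) =
      poch u p * poch u q * poch (u + v) (p + q) := by
  induction q with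
  | zero => simp [saalTerm_zero, poch_zero]
  | succ q ih =>
    have h0 : saalTerm u v p q (q + 1) = 0 := by simp [saalTerm]
    -- The telescoped recurrence for partial sums. At `n = q + 1` the boundary term disappears
    -- because `q.choose (q + 1) = 0`.
    have key : ∀ n, (u + v + q) * ∑ j ∈ range (n + 1), saalTerm u v p (q + 1) j =
        (u + q) * (u + v + p + q) * ∑ j ∈ range (n + 1), saalTerm u v p q j +
          (p - n) * (v + n) * saalTerm u v p q n := by
      intro n
      induction n with
      | zero => simpa using saalTerm_succ_zero u v p q
      | succ n ihn =>
        rw [sum_range_succ, mul_add, ihn, saalTerm_succ_succ hc, sum_range_succ _ (n + 1)]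
        ring
    have k := key (q + 1)
    rw [h0, sum_range_succ _ (q + 1), sum_range_succ _ (q + 1), h0, ← sum_range_succ] at k
    rw [poch_succ (u + v) q, ← add_assoc p q 1, poch_succ (u + v), poch_succ u q]
    push_cast
    linear_combination poch (u + v) p * poch (u + v) q * k + (u + q) * (u + v + p + q) * ih

/-! ### Means over the complex beta weight. -/

/-- The mean of `f` with respect to the (complex) beta weight `t ^ (u - 1) * (1 - t) ^ (v - 1)`
on `[0, 1]`. -/
def betaMean (u v : ℂ) (f : ℝ → ℂ) : ℂ :=
  (betaIntegral u v)⁻¹ * ∫ t in (0 : ℝ)..1, (t : ℂ) ^ (u - 1) * (1 - (t : ℂ)) ^ (v - 1) * f t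

lemma integral_congr_Ioo {f g : ℝ → ℂ} (h : ∀ t ∈ Set.Ioo (0 : ℝ) 1, f t = g t) :
    ∫ t in (0 : ℝ)..1, f t = ∫ t in (0 : ℝ)..1, g t := by
  rw [intervalIntegral.integral_of_le zero_le_one, intervalIntegral.integral_of_le zero_le_one,
    integral_Ioc_eq_integral_Ioo, integral_Ioc_eq_integral_Ioo]
  exact setIntegral_congr_fun measurableSet_Ioo h

lemma betaMean_congr {u v : ℂ} {f g : ℝ → ℂ} (h : ∀ t ∈ Set.Ioo (0 : ℝ) 1, f t = g t) :
    betaMean u v f = betaMean u v g := by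
  unfold betaMean
  rw [integral_congr_Ioo fun t ht => by rw [h t ht]]

lemma betaMean_const_mul (u v z : ℂ) (f : ℝ → ℂ) :
    betaMean u v (fun t => z * f t) = z * betaMean u v f := by
  unfold betaMean
  rw [mul_left_comm z, ← intervalIntegral.integral_const_mul z]
  congr 2
  ext t
  ring

lemma betaMean_comp_one_sub (u v : ℂ) (f : ℝ → ℂ) :
    betaMean v u (fun t => f (1 - t)) = betaMean u v f := by
  unfold betaMean
  rw [betaIntegral_symm]
  congr 1
  have h := intervalIntegral.integral_comp_sub_left (a := 0) (b := 1)
    (fun t : ℝ => (t : ℂ) ^ (u - 1) * (1 - (t : ℂ)) ^ (v - 1) * f t) 1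
  simp only [sub_self, sub_zero] at h
  rw [← h]
  congr 1
  ext t
  push_cast
  rw [sub_sub_cancel]
  ring

lemma betaMean_pow_mul_pow {u v : ℂ} (hu : 0 < u.re) (hv : 0 < v.re) (n m : ℕ) :
    betaMean u v (fun t => (t : ℂ) ^ n * (1 - (t : ℂ)) ^ m) =
      poch u n * poch v m / poch (u + v) (n + m) := by
  have huv : 0 < (u + v).re := by simpa using add_pos hu hv
  have key : ∫ t in (0 : ℝ)..1, (t : ℂ) ^ (u - 1) * (1 - (t : ℂ)) ^ (v - 1) *
      ((t : ℂ) ^ n * (1 - (t : ℂ)) ^ m) = betaIntegral (u + n) (v + m) := by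
    refine integral_congr_Ioo fun t ht => ?_
    have h0 : (t : ℂ) ≠ 0 := by exact_mod_cast ht.1.ne'
    have h1 : 1 - (t : ℂ) ≠ 0 := by
      rw [sub_ne_zero]; exact_mod_cast ht.2.ne'
    rw [show u + n - 1 = u - 1 + n by ring, show v + m - 1 = v - 1 + m by ring,
      cpow_add _ _ h0, cpow_add _ _ h1, cpow_natCast, cpow_natCast]
    ring
  have hun : 0 < (u + n).re := by
    have : (0 : ℝ) ≤ n := n.cast_nonneg
    simpa using by linarith
  have hvm : 0 < (v + m).re := by
    have : (0 : ℝ) ≤ m := m.cast_nonneg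
    simpa using by linarith
  rw [betaMean, key, betaIntegral_eq_Gamma_mul_div _ _ hu hv,
    betaIntegral_eq_Gamma_mul_div _ _ hun hvm,
    show u + n + (v + m) = u + v + ((n + m : ℕ) : ℂ) by push_cast; ring,
    Gamma_add_natCast hu, Gamma_add_natCast hv, Gamma_add_natCast huv]
  have := Gamma_ne_zero_of_re_pos hu
  have := Gamma_ne_zero_of_re_pos hv
  have := Gamma_ne_zero_of_re_pos huv
  have := poch_ne_zero huv (n + m)
  field_simp

/-- The beta mean may be taken termwise in a series that is dominated by a summable sequence of
constants. -/
lemma hasSum_betaMean {ι : Type*} [Countable ι] {u v : ℂ} (hu : 0 < u.re) (hv : 0 < v.re)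
    {F : ι → ℝ → ℂ} {f : ℝ → ℂ} {M : ι → ℝ} (hF : ∀ i, Measurable (F i)) (hM : Summable M)
    (hb : ∀ i, ∀ t ∈ Set.Icc (0 : ℝ) 1, ‖F i t‖ ≤ M i)
    (hs : ∀ t ∈ Set.Ioo (0 : ℝ) 1, HasSum (fun i => F i t) (f t)) :
    HasSum (fun i => betaMean u v (F i)) (betaMean u v f) := by
  have hw := betaIntegral_convergent hu hv
  -- The limit `f` is prescribed only in the open interval, so it is replaced by the `tsum`, which
  -- is also the limit at the endpoint `t = 1`.
  rw [betaMean, integral_congr_Ioo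
    (g := fun t => (t : ℂ) ^ (u - 1) * (1 - (t : ℂ)) ^ (v - 1) * ∑' i, F i t)
    fun t ht => by rw [(hs t ht).tsum_eq]]
  refine HasSum.mul_left _ ?_
  have hsum : ∀ t ∈ Set.Icc (0 : ℝ) 1, Summable fun i => F i t := fun t ht =>
    Summable.of_norm_bounded hM fun i => hb i t ht
  refine intervalIntegral.hasSum_integral_of_dominated_convergence
    (fun i t => ‖(t : ℂ) ^ (u - 1) * (1 - (t : ℂ)) ^ (v - 1)‖ * M i) (fun i => ?_)
    (fun i => ?_) ?_ ?_ ?_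
  · rw [Set.uIoc_of_le zero_le_one]
    rw [intervalIntegrable_iff, Set.uIoc_of_le zero_le_one] at hw
    exact hw.aestronglyMeasurable.mul (hF i).aestronglyMeasurable
  · filter_upwards with t ht
    rw [Set.uIoc_of_le zero_le_one] at ht
    rw [norm_mul]
    exact mul_le_mul_of_nonneg_left (hb i t ⟨ht.1.le, ht.2⟩) (norm_nonneg _)
  · filter_upwards with t ht using hM.mul_left _
  · simp only [tsum_mul_left]
    exact hw.norm.mul_const _
  · filter_upwards with t ht
    rw [Set.uIoc_of_le zero_le_one] at ht
    exact (hsum t ⟨ht.1.le, ht.2⟩).hasSum.mul_left _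

/-! ### Confluent hypergeometric functions: Euler's integral, Kummer's transformation, the product
formula. -/

lemma hasSum_exp (z : ℂ) : HasSum (fun n : ℕ => z ^ n / (n.factorial : ℂ)) (exp z) := by
  rw [exp_eq_exp_ℂ]; exact NormedSpace.expSeries_div_hasSum_exp z

lemma norm_pow_div_factorial (z : ℂ) (n : ℕ) :
    ‖z ^ n / (n.factorial : ℂ)‖ = ‖z‖ ^ n / (n.factorial : ℝ) := by
  rw [norm_div, norm_pow, norm_natCast]

/-- Euler's integral for `₁F₁`. -/
lemma hasSum_hyp1F1 {u v : ℂ} (hu : 0 < u.re) (hv : 0 < v.re) (z : ℂ) :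
    HasSum (fun n : ℕ => poch u n / poch (u + v) n * z ^ n / (n.factorial : ℂ))
      (betaMean u v fun t => exp (z * t)) := by
  have h := hasSum_betaMean (F := fun (n : ℕ) t => (z * t) ^ n / (n.factorial : ℂ)) hu hv
    (fun n => by fun_prop) (Real.summable_pow_div_factorial ‖z‖) (fun n t ht => ?_)
    (fun t _ => hasSum_exp (z * t))
  · convert h using 2 with n
    have h1 := betaMean_pow_mul_pow hu hv n 0
    simp only [pow_zero, mul_one, add_zero, poch_zero] at h1
    simp only [mul_pow, mul_div_right_comm]
    rw [betaMean_const_mul, h1]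
    ring
  · rw [norm_pow_div_factorial, norm_mul, norm_real, Real.norm_of_nonneg ht.1]
    have := ht.1
    gcongr
    exact mul_le_of_le_one_right (norm_nonneg z) ht.2

lemma hyp1F1_eq_betaMean {u v : ℂ} (hu : 0 < u.re) (hv : 0 < v.re) (z : ℂ) :
    hyp1F1 u (u + v) z = betaMean u v fun t => exp (z * t) :=
  (hasSum_hyp1F1 hu hv z).tsum_eq

/-- Kummer's transformation. -/
lemma exp_mul_hyp1F1_neg {u v : ℂ} (hu : 0 < u.re) (hv : 0 < v.re) (z : ℂ) :
    hyp1F1 v (u + v) z = exp z * hyp1F1 u (u + v) (-z) := by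
  rw [hyp1F1_eq_betaMean hu hv, add_comm u v, hyp1F1_eq_betaMean hv hu, ← betaMean_const_mul,
    ← betaMean_comp_one_sub]
  refine betaMean_congr fun t _ => ?_
  rw [← exp_add]
  push_cast
  ring_nf

/-- The series `₀F₁(; c; z)`. -/
def hyp0F1 (c z : ℂ) : ℂ := ∑' j : ℕ, z ^ j / (poch c j * (j.factorial : ℂ))

lemma norm_hyp0F1_term_le {c : ℂ} (hc : 0 < c.re) (z : ℂ) (j : ℕ) :
    ‖z ^ j / (poch c j * (j.factorial : ℂ))‖ ≤
      (min 1 c.re)⁻¹ * (‖z‖ ^ j / (j.factorial : ℝ)) := by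
  have h0 : 0 < min 1 c.re := lt_min one_pos hc
  rw [norm_div, norm_mul, norm_pow, norm_natCast, ← div_eq_inv_mul, div_div,
    mul_comm (j.factorial : ℝ)]
  gcongr
  exact min_one_re_le_norm_poch hc j

lemma summable_norm_hyp0F1 {c : ℂ} (hc : 0 < c.re) (z : ℂ) :
    Summable fun j : ℕ => ‖z ^ j / (poch c j * (j.factorial : ℂ))‖ :=
  Summable.of_nonneg_of_le (fun _ => norm_nonneg _) (norm_hyp0F1_term_le hc z)
    ((Real.summable_pow_div_factorial ‖z‖).mul_left _)

lemma hasSum_hyp0F1 {c : ℂ} (hc : 0 < c.re) (z : ℂ) :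
    HasSum (fun j : ℕ => z ^ j / (poch c j * (j.factorial : ℂ))) (hyp0F1 c z) :=
  (summable_norm_hyp0F1 hc z).of_norm.hasSum

lemma hasSum_mul_prod {ι κ : Type*} {f : ι → ℂ} {g : κ → ℂ} {a b : ℂ} (hf : HasSum f a)
    (hg : HasSum g b) : HasSum (fun x : ι × κ => f x.1 * g x.2) (a * b) :=
  hf.mul hg (summable_mul_of_summable_norm hf.summable.norm hg.summable.norm)

/-- Splitting `e^{(X+Y)t}` into `e^{Xt} e^{Yt}` makes every term a monomial in `X` and `Y`, ready
for comparison of coefficients. Since `t` and `1 - t` have norm at most 1, the series at `t` is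
dominated by a constant multiple of a product of three exponential series. -/
lemma hasSum_betaMean_exp_mul_hyp0F1 {u v : ℂ} (hu : 0 < u.re) (hv : 0 < v.re) (X Y : ℂ) :
    HasSum (fun i : ℕ × ℕ × ℕ => X ^ i.1 / (i.1.factorial : ℂ) * (Y ^ i.2.1 / (i.2.1.factorial : ℂ) *
        ((-(X * Y)) ^ i.2.2 / (poch (u + v) i.2.2 * (i.2.2.factorial : ℂ)))) *
        (poch u (i.1 + i.2.1 + i.2.2) * poch v i.2.2 /
          poch (u + v) (i.1 + i.2.1 + i.2.2 + i.2.2)))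
      (betaMean u v fun t => exp ((X + Y) * t) * hyp0F1 (u + v) (-(X * Y) * (t * (1 - t)))) := by
  have huv : 0 < (u + v).re := by simpa using add_pos hu hv
  have hM := (Real.summable_pow_div_factorial ‖X‖).mul_of_nonneg
    ((Real.summable_pow_div_factorial ‖Y‖).mul_of_nonneg
      ((Real.summable_pow_div_factorial ‖-(X * Y)‖).mul_left (min 1 (u + v).re)⁻¹)
      (fun _ => by positivity) (fun _ => by have := lt_min one_pos huv; positivity))
      (fun _ => by positivity) (fun _ => by have := lt_min one_pos huv; positivity)
  have h := hasSum_betaMean (F := fun (i : ℕ × ℕ × ℕ) t =>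
      (X * t) ^ i.1 / (i.1.factorial : ℂ) * ((Y * t) ^ i.2.1 / (i.2.1.factorial : ℂ) *
        ((-(X * Y) * (t * (1 - t))) ^ i.2.2 / (poch (u + v) i.2.2 * (i.2.2.factorial : ℂ)))))
      (f := fun t => exp ((X + Y) * t) * hyp0F1 (u + v) (-(X * Y) * (t * (1 - t))))
      hu hv (fun i => by fun_prop) hM (fun i t ht => ?_) (fun t _ => ?_)
  · convert h using 2 with i
    rw [← betaMean_pow_mul_pow hu hv, ← betaMean_const_mul]
    congr 1
    ext t
    simp only [mul_pow, pow_add]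
    ring
  · have h0 : ‖(t : ℂ)‖ ≤ 1 := by rw [norm_real, Real.norm_of_nonneg ht.1]; exact ht.2
    have h1 : ‖1 - (t : ℂ)‖ ≤ 1 := by
      rw [← ofReal_one, ← ofReal_sub, norm_real, Real.norm_of_nonneg (sub_nonneg.2 ht.2)]
      linarith [ht.1]
    have key : ∀ z s : ℂ, ‖s‖ ≤ 1 → ‖z * s‖ ≤ ‖z‖ := fun z s hs => by
      rw [norm_mul]; exact mul_le_of_le_one_right (norm_nonneg z) hs
    have h2 : ‖(t : ℂ) * (1 - t)‖ ≤ 1 := (key _ _ h1).trans h0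
    rw [norm_mul, norm_mul, norm_pow_div_factorial, norm_pow_div_factorial]
    have h3 : 0 < min 1 (u + v).re := lt_min one_pos huv
    gcongr
    · exact key _ _ h0
    · exact key _ _ h0
    · refine (norm_hyp0F1_term_le huv _ _).trans ?_
      gcongr
      exact key _ _ h2
  · have e : exp ((X + Y) * t) * hyp0F1 (u + v) (-(X * Y) * (t * (1 - t))) =
        exp (X * t) * (exp (Y * t) * hyp0F1 (u + v) (-(X * Y) * (t * (1 - t)))) := by
      rw [add_mul, exp_add, mul_assoc]
    rw [e]
    have h1 := hasSum_mul_prod (hasSum_exp (Y * t))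
      (hasSum_hyp0F1 huv (-(X * Y) * (t * (1 - t))))
    have h2 := hasSum_mul_prod (hasSum_exp (X * t)) h1
    exact h2

/-- The left side collects the terms of the triple series of bidegree `(p, q)`. Up to a common
factor they are the `saalTerm`s, so Pfaff–Saalschütz factors their sum. -/
lemma sum_range_eq_poch_mul_poch {u v : ℂ} (huv : 0 < (u + v).re) (X Y : ℂ) (p q : ℕ) :
    ∑ j ∈ range (q + 1), (if j ≤ p then
      X ^ (p - j) / ((p - j).factorial : ℂ) * (Y ^ (q - j) / ((q - j).factorial : ℂ) *
        ((-(X * Y)) ^ j / (poch (u + v) j * (j.factorial : ℂ)))) *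
        (poch u (p - j + (q - j) + j) * poch v j / poch (u + v) (p - j + (q - j) + j + j)) else 0) =
      (poch u p / poch (u + v) p * X ^ p / (p.factorial : ℂ)) *
        (poch u q / poch (u + v) q * Y ^ q / (q.factorial : ℂ)) := by
  have hp := poch_ne_zero huv p
  have hq := poch_ne_zero huv q
  have hpq := poch_ne_zero huv (p + q)
  have fp : (p.factorial : ℂ) ≠ 0 := by exact_mod_cast p.factorial_ne_zero
  have fq : (q.factorial : ℂ) ≠ 0 := by exact_mod_cast q.factorial_ne_zero
  have h := sum_saalTerm huv p q
  rw [← eq_div_iff (mul_ne_zero hp hq)] at h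
  trans X ^ p * Y ^ q / ((p.factorial : ℂ) * (q.factorial : ℂ) * poch (u + v) (p + q)) *
    ∑ j ∈ range (q + 1), saalTerm u v p q j
  · rw [mul_sum]
    refine sum_congr rfl fun j hj => ?_
    have hjq : j ≤ q := Nat.lt_succ_iff.mp (mem_range.mp hj)
    split_ifs with hjp
    · have e1 : p - j + (q - j) + j = p + q - j := by omega
      have e2 : p + q - j + j = p + q := by omega
      have hd : ((p - j).factorial : ℂ) * (p.descFactorial j : ℂ) = p.factorial := by
        exact_mod_cast Nat.factorial_mul_descFactorial hjp
      have hc : (q.choose j : ℂ) * (j.factorial : ℂ) * ((q - j).factorial : ℂ) = q.factorial := by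
        exact_mod_cast Nat.choose_mul_factorial_mul_factorial hjq
      have hX : X ^ p = X ^ (p - j) * X ^ j := by rw [← pow_add, Nat.sub_add_cancel hjp]
      have hY : Y ^ q = Y ^ (q - j) * Y ^ j := by rw [← pow_add, Nat.sub_add_cancel hjq]
      have f1 : ((p - j).factorial : ℂ) ≠ 0 := by exact_mod_cast Nat.factorial_ne_zero _
      have f2 : ((q - j).factorial : ℂ) ≠ 0 := by exact_mod_cast Nat.factorial_ne_zero _
      have f3 : (j.factorial : ℂ) ≠ 0 := by exact_mod_cast Nat.factorial_ne_zero _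
      have f4 : (q.choose j : ℂ) ≠ 0 := by exact_mod_cast (Nat.choose_pos hjq).ne'
      have f5 : (p.descFactorial j : ℂ) ≠ 0 := by
        exact_mod_cast (Nat.descFactorial_pos.2 hjp).ne'
      have := poch_ne_zero huv j
      rw [saalTerm, e1, e2, ← hd, ← hc, hX, hY, neg_pow, mul_pow]
      field_simp
    · rw [saalTerm, Nat.descFactorial_of_lt (not_le.mp hjp)]
      simp
  · rw [h]
    field_simp

/-- The product formula of Burchnall and Chaundy for two `₁F₁`, in integral form. -/
lemma betaMean_exp_mul_hyp0F1 {u v : ℂ} (hu : 0 < u.re) (hv : 0 < v.re) (X Y : ℂ) :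
    (betaMean u v fun t => exp ((X + Y) * t) * hyp0F1 (u + v) (-(X * Y) * (t * (1 - t)))) =
      hyp1F1 u (u + v) X * hyp1F1 u (u + v) Y := by
  have huv : 0 < (u + v).re := by simpa using add_pos hu hv
  -- Reindexing by the total degrees in `X` and `Y`. The image is `j ≤ p`, `j ≤ q`, and `g` extends
  -- the terms by zero outside it, so that the sum can be taken fibrewise over `(p, q)`.
  let e : ℕ × ℕ × ℕ → (ℕ × ℕ) × ℕ := fun i => ((i.1 + i.2.2, i.2.1 + i.2.2), i.2.2)
  have he : Function.Injective e := by
    rintro ⟨l, m, j⟩ ⟨l', m', j'⟩ h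
    simp only [e, Prod.mk.injEq] at h ⊢
    omega
  let g : (ℕ × ℕ) × ℕ → ℂ := fun i => if i.2 ≤ i.1.2 then (if i.2 ≤ i.1.1 then
      X ^ (i.1.1 - i.2) / ((i.1.1 - i.2).factorial : ℂ) *
        (Y ^ (i.1.2 - i.2) / ((i.1.2 - i.2).factorial : ℂ) *
        ((-(X * Y)) ^ i.2 / (poch (u + v) i.2 * (i.2.factorial : ℂ)))) *
        (poch u (i.1.1 - i.2 + (i.1.2 - i.2) + i.2) * poch v i.2 /
          poch (u + v) (i.1.1 - i.2 + (i.1.2 - i.2) + i.2 + i.2)) else 0) else 0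
  have hg : ∀ x, x ∉ Set.range e → g x = 0 := by
    rintro ⟨⟨p, q⟩, j⟩ hx
    simp only [g]
    split_ifs with h1 h2
    · refine absurd ⟨(p - j, q - j, j), ?_⟩ hx
      have h1' : j ≤ q := h1
      have h2' : j ≤ p := h2
      change ((p - j + j, q - j + j), j) = ((p, q), j)
      rw [Nat.sub_add_cancel h1', Nat.sub_add_cancel h2']
    · rfl
    · rfl
  have h1 : HasSum g (betaMean u v fun t =>
      exp ((X + Y) * t) * hyp0F1 (u + v) (-(X * Y) * (t * (1 - t)))) := by
    rw [← he.hasSum_iff hg]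
    convert hasSum_betaMean_exp_mul_hyp0F1 hu hv X Y using 2 with i
    simp [g, e]
  have h2 := h1.prod_fiberwise (g := fun pq : ℕ × ℕ =>
    (poch u pq.1 / poch (u + v) pq.1 * X ^ pq.1 / (pq.1.factorial : ℂ)) *
        (poch u pq.2 / poch (u + v) pq.2 * Y ^ pq.2 / (pq.2.factorial : ℂ))) (fun ⟨p, q⟩ => by
    rw [← sum_range_eq_poch_mul_poch huv]
    rw [sum_congr rfl (g := fun j => g ((p, q), j)) fun j hj => by
      simp only [g]; rw [if_pos (Nat.lt_succ_iff.mp (mem_range.mp hj))]]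
    refine hasSum_sum_of_ne_finset_zero fun j hj => ?_
    have : ¬ j ≤ q := fun h => hj (mem_range.mpr (Nat.lt_succ_of_le h))
    simp only [g]
    rw [if_neg this])
  rw [hyp1F1_eq_betaMean hu hv, hyp1F1_eq_betaMean hu hv]
  have h3 := hasSum_mul_prod (hasSum_hyp1F1 hu hv X) (hasSum_hyp1F1 hu hv Y)
  exact h2.unique h3

/-! ### Chebyshev polynomials and their beta means. -/

lemma hasSum_of_eq {ι : Type*} {f g : ι → ℂ} {a b : ℂ} (hf : HasSum f a) (h : ∀ i, g i = f i)
    (hab : b = a) : HasSum g b := by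
  rwa [funext h, hab]

/-- Taylor's formula at 1, used because the derivatives of Chebyshev polynomials at 1 are explicit
products. -/
lemma hasSum_derivative_eval_one (f : Polynomial ℂ) (t : ℂ) :
    HasSum (fun j : ℕ => (Polynomial.derivative^[j] f).eval 1 / (j.factorial : ℂ) * (-2 * t) ^ j)
      (f.eval (1 - 2 * t)) := by
  have h1 : ∀ j : ℕ, (Polynomial.derivative^[j] f).eval 1 / (j.factorial : ℂ) =
      (Polynomial.taylor 1 f).coeff j := fun j => by
    rw [Polynomial.taylor_coeff, div_eq_iff (by exact_mod_cast j.factorial_ne_zero),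
      ← Polynomial.factorial_smul_hasseDeriv]
    simp [mul_comm]
  simp only [h1]
  have h2 : f.eval (1 - 2 * t) = ∑ j ∈ range ((Polynomial.taylor 1 f).natDegree + 1),
      (Polynomial.taylor 1 f).coeff j * (-2 * t) ^ j := by
    rw [← Polynomial.eval_eq_sum_range, Polynomial.taylor_eval]
    congr 1
    ring
  rw [h2]
  refine hasSum_sum_of_ne_finset_zero fun j hj => ?_
  rw [Polynomial.coeff_eq_zero_of_natDegree_lt, zero_mul]
  simpa [Nat.lt_succ_iff] using hj

/-- The Chebyshev polynomial of the first kind as a `₂F₁`. -/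
lemma hasSum_cos_nat_mul (n : ℕ) {θ t : ℂ} (h : cos θ = 1 - 2 * t) :
    HasSum (fun j : ℕ => poch (-n) j * poch n j / (poch (1 / 2) j * (j.factorial : ℂ)) * t ^ j)
      (cos (n * θ)) := by
  have h1 := hasSum_derivative_eval_one (Polynomial.Chebyshev.T ℂ n) t
  rw [← h, Polynomial.Chebyshev.T_complex_cos] at h1
  push_cast at h1
  convert h1 using 2 with j
  -- Factor by factor: `n² - l² = -(-n + l)(n + l)` and `2(1/2 + l) = 2l + 1`.
  have key : (∏ l ∈ range j, ((n : ℂ) ^ 2 - (l : ℂ) ^ 2)) * (-2) ^ j * poch (1 / 2) j =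
      poch (-n) j * poch n j * ∏ l ∈ range j, (2 * (l : ℂ) + 1) := by
    induction j with
    | zero => simp [poch_zero]
    | succ j ih =>
      simp only [prod_range_succ, poch_succ, pow_succ (-2 : ℂ) j]
      linear_combination ((n : ℂ) ^ 2 - (j : ℂ) ^ 2) * (-2) * (1 / 2 + j) * ih
  have hj : (j.factorial : ℂ) ≠ 0 := by exact_mod_cast j.factorial_ne_zero
  have hp : poch (1 / 2) j ≠ 0 := poch_ne_zero (by norm_num) j
  have hq : (∏ l ∈ range j, (2 * (l : ℂ) + 1)) ≠ 0 :=
    prod_ne_zero_iff.2 fun l _ => by exact_mod_cast (2 * l).succ_ne_zero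
  rw [Polynomial.Chebyshev.iterate_derivative_T_eval_one_eq_div]
  push_cast
  rw [mul_pow]
  field_simp
  linear_combination -t ^ j * key

/-- The Chebyshev polynomial of the second kind as a `₂F₁`. -/
lemma hasSum_sin_nat_mul_div (n : ℕ) {θ t : ℂ} (h : cos θ = 1 - 2 * t) (hθ : sin θ ≠ 0) :
    HasSum (fun j : ℕ => n * (poch (1 - n) j * poch (1 + n) j /
      (poch (3 / 2) j * (j.factorial : ℂ))) * t ^ j) (sin (n * θ) / sin θ) := by
  -- The index is an integer, so `n = 0` is covered by `U_{-1} = 0`.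
  have h1 := hasSum_derivative_eval_one (Polynomial.Chebyshev.U ℂ (n - 1)) t
  have h2 := Polynomial.Chebyshev.U_complex_cos θ (n - 1)
  push_cast at h2
  rw [sub_add_cancel, ← eq_div_iff hθ] at h2
  rw [← h, h2] at h1
  convert h1 using 2 with j
  have key : (∏ l ∈ range j, ((n : ℂ) ^ 2 - ((l : ℂ) + 1) ^ 2)) * (-2) ^ j * poch (3 / 2) j =
      poch (1 - n) j * poch (1 + n) j * ∏ l ∈ range j, (2 * (l : ℂ) + 3) := by
    induction j with
    | zero => simp [poch_zero]
    | succ j ih =>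
      simp only [prod_range_succ, poch_succ, pow_succ (-2 : ℂ) j]
      linear_combination ((n : ℂ) ^ 2 - ((j : ℂ) + 1) ^ 2) * (-2) * (3 / 2 + j) * ih
  have hj : (j.factorial : ℂ) ≠ 0 := by exact_mod_cast j.factorial_ne_zero
  have hp : poch (3 / 2) j ≠ 0 := poch_ne_zero (by norm_num) j
  have hq : (∏ l ∈ range j, (2 * (l : ℂ) + 3)) ≠ 0 :=
    prod_ne_zero_iff.2 fun l _ => by exact_mod_cast (2 * l + 2).succ_ne_zero
  rw [Polynomial.Chebyshev.iterate_derivative_U_eval_one_eq_div]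
  push_cast
  rw [mul_pow]
  simp only [sub_add_cancel]
  field_simp
  linear_combination -n * t ^ j * key

/-- The mean of `t^j` adds one upper parameter `u` and one lower parameter `u + v`; this turns the
`₂F₁` of a Chebyshev polynomial into a `₃F₂`. -/
lemma betaMean_eq_tsum_of_polynomial {u v : ℂ} (hu : 0 < u.re) (hv : 0 < v.re) {a : ℕ → ℂ}
    {f : ℝ → ℂ} {N : ℕ} (ha : ∀ j, N < j → a j = 0)
    (hf : ∀ t ∈ Set.Ioo (0 : ℝ) 1, HasSum (fun j => a j * (t : ℂ) ^ j) (f t)) :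
    betaMean u v f = ∑' j, a j * (poch u j / poch (u + v) j) := by
  have hM : Summable fun j => ‖a j‖ := summable_of_ne_finset_zero (s := range (N + 1)) fun j hj => by
    rw [ha j (by simpa [Nat.lt_succ_iff] using hj), norm_zero]
  have h := hasSum_betaMean (F := fun j t => a j * (t : ℂ) ^ j) hu hv (fun j => by fun_prop) hM
    (fun j t ht => ?_) hf
  · rw [← h.tsum_eq]
    congr 1
    ext j
    have h1 := betaMean_pow_mul_pow hu hv j 0
    simp only [pow_zero, mul_one, add_zero, poch_zero] at h1
    rw [betaMean_const_mul, h1]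
  · rw [norm_mul, norm_pow, norm_real, Real.norm_of_nonneg ht.1]
    exact mul_le_of_le_one_right (norm_nonneg _) (pow_le_one₀ ht.1 ht.2)

lemma cos_arccos_one_sub_two_mul {t : ℝ} (ht : t ∈ Set.Icc (0 : ℝ) 1) :
    Real.cos (Real.arccos (1 - 2 * t)) = 1 - 2 * t :=
  Real.cos_arccos (by linarith [ht.2]) (by linarith [ht.1])

lemma sin_arccos_one_sub_two_mul_ne_zero {t : ℝ} (ht : t ∈ Set.Ioo (0 : ℝ) 1) :
    Real.sin (Real.arccos (1 - 2 * t)) ≠ 0 := by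
  rw [Real.sin_arccos]
  exact (Real.sqrt_pos.2 (by nlinarith [ht.1, ht.2])).ne'

lemma hyp3F2_eq_betaMean_cos {u v : ℂ} (hu : 0 < u.re) (hv : 0 < v.re) (huv : u + v = 1 / 2)
    (m : ℤ) :
    hyp3F2 (-(m.natAbs : ℂ)) m.natAbs u (1 / 2) (1 / 2) 1 =
      betaMean u v fun t => (Real.cos (m * Real.arccos (1 - 2 * t)) : ℂ) := by
  have hc : ∀ x : ℝ, Real.cos (m * x) = Real.cos (m.natAbs * x) := fun x => by
    rcases Int.natAbs_eq m with h | h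
    · rw [h]; simp
    · rw [h]; simp
  simp only [hc]
  rw [betaMean_eq_tsum_of_polynomial (N := m.natAbs) hu hv (a := fun j => poch (-(m.natAbs : ℂ)) j *
    poch m.natAbs j / (poch (1 / 2) j * (j.factorial : ℂ))) (fun j hj => ?_) (fun t ht => ?_), huv]
  · unfold hyp3F2
    congr 1
    ext j
    rw [one_pow]
    ring
  · rw [poch_neg_eq_zero hj]; simp
  · rw [ofReal_cos, ofReal_mul, ofReal_natCast]
    refine hasSum_cos_nat_mul _ ?_
    rw [← ofReal_cos, cos_arccos_one_sub_two_mul ⟨ht.1.le, ht.2.le⟩]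
    push_cast
    rfl

lemma hyp3F2_eq_betaMean_sin {u v : ℂ} (hu : 0 < u.re) (hv : 0 < v.re) (huv : u + v = 3 / 2)
    (m : ℤ) :
    m * hyp3F2 (1 - (m.natAbs : ℂ)) (1 + (m.natAbs : ℂ)) u (3 / 2) (3 / 2) 1 =
      betaMean u v fun t => ((Real.sin (m * Real.arccos (1 - 2 * t)) /
        Real.sin (Real.arccos (1 - 2 * t)) : ℝ) : ℂ) := by
  have key : ∀ n : ℕ, n * hyp3F2 (1 - (n : ℂ)) (1 + (n : ℂ)) u (3 / 2) (3 / 2) 1 =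
      betaMean u v fun t => ((Real.sin (n * Real.arccos (1 - 2 * t)) /
        Real.sin (Real.arccos (1 - 2 * t)) : ℝ) : ℂ) := by
    intro n
    rw [betaMean_eq_tsum_of_polynomial (N := n) hu hv (a := fun j => n * (poch (1 - n) j *
      poch (1 + n) j / (poch (3 / 2) j * (j.factorial : ℂ)))) (fun j hj => ?_) (fun t ht => ?_),
      huv]
    · unfold hyp3F2
      rw [← tsum_mul_left]
      congr 1
      ext j
      rw [one_pow]
      ring
    -- For `n = 0` the upper parameter `1 - n` does not terminate the series; the prefactor `n`
    -- kills the coefficients instead.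
    · rcases n with _ | n
      · simp
      · rw [Nat.cast_succ, show 1 - ((n : ℂ) + 1) = -n by ring, poch_neg_eq_zero (by omega)]; simp
    · rw [ofReal_div, ofReal_sin, ofReal_mul, ofReal_natCast, ofReal_sin]
      refine hasSum_sin_nat_mul_div _ ?_ ?_
      · rw [← ofReal_cos, cos_arccos_one_sub_two_mul ⟨ht.1.le, ht.2.le⟩]
        push_cast
        rfl
      · rw [← ofReal_sin]
        exact_mod_cast sin_arccos_one_sub_two_mul_ne_zero ht
  rcases Int.natAbs_eq m with h | h
  · have := key m.natAbs
    rw [← Int.cast_natCast (R := ℝ), ← h] at this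
    rw [← this]
    congr 1
    conv_lhs => rw [h]
    exact Int.cast_natCast _
  · have h2 : ((m : ℤ) : ℂ) = -(m.natAbs : ℂ) := by exact_mod_cast congrArg (Int.cast : ℤ → ℂ) h
    have h3 : ((m : ℤ) : ℝ) = -(m.natAbs : ℝ) := by exact_mod_cast congrArg (Int.cast : ℤ → ℝ) h
    rw [h2, neg_mul, key, ← neg_one_mul, ← betaMean_const_mul, h3]
    congr 1
    ext t
    rw [neg_mul (m.natAbs : ℝ), Real.sin_neg]
    push_cast
    ring

/-! ### Cosine and sine as `₀F₁`. -/

lemma factorial_two_mul_eq_poch (j : ℕ) :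
    ((2 * j).factorial : ℂ) = 4 ^ j * (poch (1 / 2) j * (j.factorial : ℂ)) := by
  induction j with
  | zero => simp [poch_zero]
  | succ j ih =>
    rw [show 2 * (j + 1) = 2 * j + 1 + 1 by ring, Nat.factorial_succ, Nat.factorial_succ,
      Nat.factorial_succ j, poch_succ]
    push_cast
    rw [ih]
    ring

lemma factorial_two_mul_add_one_eq_poch (j : ℕ) :
    ((2 * j + 1).factorial : ℂ) = 4 ^ j * (poch (3 / 2) j * (j.factorial : ℂ)) := by
  induction j with
  | zero => simp [poch_zero]
  | succ j ih =>
    rw [show 2 * (j + 1) + 1 = 2 * j + 1 + 1 + 1 by ring, Nat.factorial_succ, Nat.factorial_succ,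
      Nat.factorial_succ j, poch_succ]
    push_cast
    rw [ih]
    ring

lemma cos_eq_hyp0F1 (z : ℂ) : cos z = hyp0F1 (1 / 2) (-(z ^ 2 / 4)) := by
  refine (hasSum_cos z).unique ?_
  convert hasSum_hyp0F1 (c := 1 / 2) (by norm_num) (-(z ^ 2 / 4)) using 2 with j
  rw [factorial_two_mul_eq_poch, neg_pow (z ^ 2 / 4), div_pow, pow_mul z]
  ring

lemma sin_eq_mul_hyp0F1 (z : ℂ) : sin z = z * hyp0F1 (3 / 2) (-(z ^ 2 / 4)) := by
  have h := (hasSum_hyp0F1 (c := 3 / 2) (by norm_num) (-(z ^ 2 / 4))).mul_left z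
  refine (hasSum_sin z).unique (hasSum_of_eq h (fun j => ?_) rfl)
  rw [factorial_two_mul_add_one_eq_poch, neg_pow (z ^ 2 / 4), div_pow, pow_succ z, pow_mul z]
  ring

/-! ### Bessel functions and the Jacobi–Anger expansion. -/

/-- Pairs of natural numbers, indexed by their difference and their minimum. -/
def natPairEquiv : ℤ × ℕ ≃ ℕ × ℕ where
  toFun i := (i.2 + i.1.toNat, i.2 + (-i.1).toNat)
  invFun p := ((p.1 : ℤ) - p.2, min p.1 p.2)
  left_inv := by
    rintro ⟨m, j⟩
    simp only [Prod.mk.injEq]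
    omega
  right_inv := by
    rintro ⟨a, b⟩
    simp only [Prod.mk.injEq]
    omega

lemma norm_besselJ_term_le (n j : ℕ) (x : ℝ) :
    ‖(-1) ^ j / ((j.factorial : ℝ) * ((j + n).factorial : ℝ)) * (x / 2) ^ (2 * j + n)‖ ≤
      |x / 2| ^ n / (n.factorial : ℝ) * (((x / 2) ^ 2) ^ j / (j.factorial : ℝ)) := by
  have h : (n.factorial : ℝ) ≤ (j + n).factorial := by
    exact_mod_cast Nat.factorial_le (Nat.le_add_left n j)
  rw [norm_mul, norm_div, norm_pow, norm_neg, norm_one, one_pow, norm_pow, Real.norm_eq_abs,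
    Real.norm_eq_abs, abs_of_pos (by positivity), pow_add, pow_mul, sq_abs,
    show |x / 2| ^ n / (n.factorial : ℝ) * (((x / 2) ^ 2) ^ j / (j.factorial : ℝ)) =
      1 / (j.factorial * n.factorial) * (((x / 2) ^ 2) ^ j * |x / 2| ^ n) by ring]
  gcongr

lemma hasSum_besselJ (n : ℕ) (x : ℝ) :
    HasSum (fun j : ℕ => (-1) ^ j / ((j.factorial : ℝ) * ((j + n).factorial : ℝ)) *
      (x / 2) ^ (2 * j + n)) (besselJ n x) :=
  (Summable.of_norm_bounded ((Real.summable_pow_div_factorial ((x / 2) ^ 2)).mul_left _)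
    fun j => norm_besselJ_term_le n j x).hasSum

lemma abs_besselJ_le (n : ℕ) (x : ℝ) :
    |besselJ n x| ≤ |x / 2| ^ n / (n.factorial : ℝ) * Real.exp ((x / 2) ^ 2) := by
  have h1 : HasSum (fun j : ℕ => ((x / 2) ^ 2) ^ j / (j.factorial : ℝ))
      (Real.exp ((x / 2) ^ 2)) := by
    rw [Real.exp_eq_exp_ℝ]; exact NormedSpace.expSeries_div_hasSum_exp _
  exact tsum_of_norm_bounded (h1.mul_left _) fun j => norm_besselJ_term_le n j x

/-- The leading term `(1/2)^n / n!` outweighs the rest, which a geometric series of ratio `1/4`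
bounds by one third of it. -/
lemma besselJ_one_ne_zero (n : ℕ) : besselJ n 1 ≠ 0 := by
  intro h0
  have h := hasSum_besselJ n 1
  rw [h0, ← hasSum_nat_add_iff' 1] at h
  have hg : HasSum (fun j : ℕ => (1 / 2 : ℝ) ^ n / n.factorial * (1 / 4 * (1 / 4) ^ j))
      ((1 / 2 : ℝ) ^ n / n.factorial * (1 / 4 * (1 - 1 / 4)⁻¹)) :=
    ((hasSum_geometric_of_lt_one (by norm_num) (by norm_num)).mul_left _).mul_left _
  have hb : ∀ j : ℕ, ‖(-1 : ℝ) ^ (j + 1) / (((j + 1).factorial : ℝ) *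
      ((j + 1 + n).factorial : ℝ)) * (1 / 2) ^ (2 * (j + 1) + n)‖ ≤
      (1 / 2 : ℝ) ^ n / n.factorial * (1 / 4 * (1 / 4) ^ j) := fun j => ?_
  · have hle := tsum_of_norm_bounded hg hb
    rw [h.tsum_eq] at hle
    have hp : 0 < (1 / 2 : ℝ) ^ n / n.factorial := by positivity
    simp only [sum_range_one, pow_zero, Nat.factorial_zero, Nat.cast_one, zero_add, one_mul,
      mul_zero, zero_sub, norm_neg] at hle
    rw [show 1 / (n.factorial : ℝ) * (1 / 2) ^ n = (1 / 2 : ℝ) ^ n / n.factorial by ring,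
      Real.norm_of_nonneg hp.le] at hle
    linarith
  · refine (norm_besselJ_term_le n (j + 1) 1).trans ?_
    rw [abs_of_pos (by norm_num : (0 : ℝ) < 1 / 2)]
    gcongr
    rw [← pow_succ', show ((1 : ℝ) / 2) ^ 2 = 1 / 4 by norm_num]
    exact div_le_self (by positivity) (by exact_mod_cast Nat.factorial_pos _)

lemma exp_int_mul (m : ℤ) (z : ℂ) :
    exp (m * z) = exp z ^ m.toNat * exp (-z) ^ (-m).toNat := by
  rw [← exp_nat_mul, ← exp_nat_mul, ← exp_add]
  have h : (m : ℂ) = (m.toNat : ℂ) - ((-m).toNat : ℂ) := by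
    exact_mod_cast congrArg (Int.cast : ℤ → ℂ) (Int.toNat_sub_toNat_neg m).symm
  rw [h]
  ring_nf

/-- The Jacobi–Anger expansion of a plane wave. -/
lemma hasSum_jacobiAnger (x ψ : ℝ) :
    HasSum (fun m : ℤ => (-I) ^ m.natAbs * (besselJ m.natAbs x : ℂ) * exp (m * (I * ψ)))
      (exp (-(I * x * Real.cos ψ))) := by
  -- By Euler's formula `S + T = -ix cos ψ`. In `e^S e^T` the terms `S^a T^b` with `a - b = m` carry
  -- `e^{imψ}`, and summing over `min a b` gives the Bessel series.
  set S : ℂ := -I * (x / 2) * exp (I * ψ)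
  set T : ℂ := -I * (x / 2) * exp (-(I * ψ))
  have h := hasSum_mul_prod (hasSum_exp S) (hasSum_exp T)
  rw [← exp_add, ← natPairEquiv.hasSum_iff] at h
  have e : S + T = -(I * x * Real.cos ψ) := by
    rw [ofReal_cos, Complex.cos]
    simp only [S, T, mul_comm I (ψ : ℂ), neg_mul]
    ring
  rw [e] at h
  refine h.prod_fiberwise fun m => ?_
  have hb := ((hasSum_ofReal.2 (hasSum_besselJ m.natAbs x)).mul_left
    ((-I) ^ m.natAbs)).mul_right (exp (m * (I * ψ)))
  refine hasSum_of_eq hb (fun j => ?_) rfl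
  have hE : exp (I * ψ) ^ j * exp (-(I * ψ)) ^ j = 1 := by
    rw [← mul_pow, ← exp_add]; simp
  have hI : (-I) ^ j * (-I) ^ j = (-1) ^ j := by
    rw [← mul_pow]; simp
  have hm : m.natAbs = m.toNat + (-m).toNat := by omega
  have hf : (((j + m.toNat).factorial : ℂ) * ((j + (-m).toNat).factorial : ℂ)) =
      (j.factorial : ℂ) * ((j + m.natAbs).factorial : ℂ) := by
    rcases le_total 0 m with h | h
    · rw [show (-m).toNat = 0 by omega, show m.natAbs = m.toNat by omega]; simp [mul_comm]
    · rw [show m.toNat = 0 by omega, show m.natAbs = (-m).toNat by omega]; simp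
  simp only [natPairEquiv, Equiv.coe_fn_mk, Function.comp, S, T]
  rw [div_mul_div_comm, hf, exp_int_mul, hm]
  push_cast
  simp only [mul_pow, pow_add, two_mul]
  rw [← hI]
  generalize exp (I * ψ) ^ j = a at *
  generalize exp (-(I * ψ)) ^ j = b at *
  linear_combination ((-I) ^ j * (-I) ^ j * (-I) ^ m.toNat * (-I) ^ (-m).toNat * (x / 2) ^ j *
    (x / 2) ^ j * (x / 2) ^ m.toNat * (x / 2) ^ (-m).toNat * exp (I * ψ) ^ m.toNat *
    exp (-(I * ψ)) ^ (-m).toNat /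
      ((j.factorial : ℂ) * ((j + (m.toNat + (-m).toNat)).factorial : ℂ))) * hE

/-- Half the sum of the plane-wave expansions in the directions `φ + θ` and `φ - θ`; the sine
version below takes `-i/2` times their difference. -/
lemma hasSum_jacobiAnger_cos (x φ θ : ℝ) :
    HasSum (fun m : ℤ => (-I) ^ m.natAbs * (besselJ m.natAbs x : ℂ) * exp (m * (I * φ)) *
      (Real.cos (m * θ) : ℂ))
      (exp (-(I * x * Real.cos φ * Real.cos θ)) * cos (x * Real.sin φ * Real.sin θ)) := by
  have h := ((hasSum_jacobiAnger x (φ + θ)).add (hasSum_jacobiAnger x (φ - θ))).mul_left (1 / 2)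
  have hc : ∀ z, cos z = (exp (z * I) + exp (-z * I)) / 2 := fun _ => rfl
  refine hasSum_of_eq h (fun m => ?_) ?_
  · rw [ofReal_cos, hc]
    push_cast
    rw [show (m : ℂ) * (I * (φ + θ)) = m * (I * φ) + m * θ * I by ring,
      show (m : ℂ) * (I * (φ - θ)) = m * (I * φ) + -(m * θ) * I by ring, exp_add, exp_add]
    ring
  · rw [hc, Real.cos_add, Real.cos_sub]
    push_cast
    rw [show -(I * x * (cos φ * cos θ - sin φ * sin θ)) =
        -(I * x * cos φ * cos θ) + x * sin φ * sin θ * I by ring,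
      show -(I * x * (cos φ * cos θ + sin φ * sin θ)) =
        -(I * x * cos φ * cos θ) + -(x * sin φ * sin θ) * I by ring, exp_add, exp_add]
    ring

lemma hasSum_jacobiAnger_sin (x φ θ : ℝ) :
    HasSum (fun m : ℤ => (-I) ^ m.natAbs * (besselJ m.natAbs x : ℂ) * exp (m * (I * φ)) *
      (Real.sin (m * θ) : ℂ))
      (exp (-(I * x * Real.cos φ * Real.cos θ)) * sin (x * Real.sin φ * Real.sin θ)) := by
  have h := ((hasSum_jacobiAnger x (φ + θ)).sub (hasSum_jacobiAnger x (φ - θ))).mul_left (-I / 2)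
  have hc : ∀ z, sin z = (exp (-z * I) - exp (z * I)) * I / 2 := fun _ => rfl
  refine hasSum_of_eq h (fun m => ?_) ?_
  · rw [ofReal_sin, hc]
    push_cast
    rw [show (m : ℂ) * (I * (φ + θ)) = m * (I * φ) + m * θ * I by ring,
      show (m : ℂ) * (I * (φ - θ)) = m * (I * φ) + -(m * θ) * I by ring, exp_add, exp_add]
    ring
  · rw [hc, Real.cos_add, Real.cos_sub]
    push_cast
    rw [show -(I * x * (cos φ * cos θ - sin φ * sin θ)) =
        -(I * x * cos φ * cos θ) + x * sin φ * sin θ * I by ring,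
      show -(I * x * (cos φ * cos θ + sin φ * sin θ)) =
        -(I * x * cos φ * cos θ) + -(x * sin φ * sin θ) * I by ring, exp_add, exp_add]
    ring

/-- Supplies the dominating series in the odd case, where `sin mθ / sin θ` can be as large as `|m|`.
-/
lemma summable_mul_besselJ (x : ℝ) :
    Summable fun m : ℤ => |(m : ℝ)| * |besselJ m.natAbs x| := by
  have h1 : Summable fun n : ℕ => (n : ℝ) * |besselJ n x| := by
    have h2 : Summable fun n : ℕ =>
        (n : ℝ) * (|x / 2| ^ n / (n.factorial : ℝ) * Real.exp ((x / 2) ^ 2)) := by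
      rw [← summable_nat_add_iff 1]
      refine ((Real.summable_pow_div_factorial |x / 2|).mul_left
        (|x / 2| * Real.exp ((x / 2) ^ 2))).congr fun n => ?_
      rw [Nat.factorial_succ]
      push_cast
      field_simp
      ring
    exact Summable.of_nonneg_of_le (fun n => by positivity)
      (fun n => mul_le_mul_of_nonneg_left (abs_besselJ_le n x) n.cast_nonneg) h2
  refine Summable.of_nat_of_neg ?_ ?_
  · simpa using h1
  · simpa using h1

lemma abs_sin_int_mul_le (m : ℤ) (θ : ℝ) : |Real.sin (m * θ)| ≤ |(m : ℝ)| * |Real.sin θ| := by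
  have key : ∀ n : ℕ, |Real.sin (n * θ)| ≤ n * |Real.sin θ| := by
    intro n
    induction n with
    | zero => simp
    | succ n ih =>
      push_cast
      rw [add_mul, one_mul, Real.sin_add]
      calc |Real.sin (n * θ) * Real.cos θ + Real.cos (n * θ) * Real.sin θ|
          ≤ |Real.sin (n * θ)| * |Real.cos θ| + |Real.cos (n * θ)| * |Real.sin θ| := by
            rw [← abs_mul, ← abs_mul]; exact abs_add_le _ _
        _ ≤ |Real.sin (n * θ)| * 1 + 1 * |Real.sin θ| := by
            gcongr
            · exact Real.abs_cos_le_one _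
            · exact Real.abs_cos_le_one _
        _ ≤ _ := by linarith
  rcases Int.natAbs_eq m with h | h <;> rw [h] <;> simpa using key m.natAbs

/-! ### Uniqueness of the coefficients. -/

lemma integral_exp_I_mul_int (m : ℤ) :
    ∫ φ in (0 : ℝ)..2 * Real.pi, exp (I * m * φ) = if m = 0 then 2 * (Real.pi : ℂ) else 0 := by
  split_ifs with hm
  · simp [hm]
  · have h : I * (m : ℂ) ≠ 0 := mul_ne_zero I_ne_zero (by exact_mod_cast hm)
    rw [integral_exp_mul_complex h]
    have e : I * (m : ℂ) * ((2 * Real.pi : ℝ) : ℂ) = m * (2 * Real.pi * I) := by push_cast; ring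
    rw [e, exp_int_mul_two_pi_mul_I]
    simp

/-- The coefficients of a convergent Fourier series with sum zero vanish. -/
lemma eq_zero_of_hasSum_exp_zero {d : ℤ → ℂ}
    (h : ∀ φ ∈ Set.Ico (0 : ℝ) (2 * Real.pi), HasSum (fun m : ℤ => d m * exp (I * m * φ)) 0)
    (n : ℤ) : d n = 0 := by
  -- At `φ = 0` every exponential is 1, and summability in `ℂ` is absolute; this justifies
  -- integrating termwise.
  have hsum : Summable fun m => ‖d m‖ := by
    simpa using (h 0 ⟨le_rfl, Real.two_pi_pos⟩).summable.norm
  have hnorm : ∀ (m : ℤ) (φ : ℝ), ‖exp (I * m * φ)‖ = 1 := fun m φ => by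
    rw [show I * (m : ℂ) * φ = ((m * φ : ℝ) : ℂ) * I by push_cast; ring, norm_exp_ofReal_mul_I]
  have key := intervalIntegral.hasSum_integral_of_dominated_convergence (μ := volume)
    (a := 0) (b := 2 * Real.pi) (F := fun (m : ℤ) (φ : ℝ) => d m * exp (I * (m - n : ℤ) * φ))
    (f := fun _ => (0 : ℂ)) (fun m _ => ‖d m‖) (fun m => by fun_prop)
    (fun m => by
      filter_upwards with φ _
      rw [norm_mul, hnorm, mul_one])
    (by filter_upwards with φ _ using hsum) intervalIntegrable_const
    (by
      filter_upwards [Measure.ae_ne volume (2 * Real.pi)] with φ hne hφ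
      rw [Set.uIoc_of_le Real.two_pi_pos.le] at hφ
      refine hasSum_of_eq ((h φ ⟨hφ.1.le, lt_of_le_of_ne hφ.2 hne⟩).mul_right (exp (I * (-n : ℤ) * φ)))
        (fun m => ?_) (zero_mul _).symm
      rw [mul_assoc (d m) (exp _), ← exp_add]
      push_cast
      ring_nf)
  simp only [intervalIntegral.integral_const_mul, integral_exp_I_mul_int,
    intervalIntegral.integral_zero, sub_eq_zero] at key
  have h1 := key.unique (hasSum_single n fun m hm => by rw [if_neg hm, mul_zero])
  rw [if_pos rfl] at h1
  have hpi : 2 * (Real.pi : ℂ) ≠ 0 := by exact_mod_cast Real.two_pi_pos.ne'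
  exact (mul_eq_zero.mp h1.symm).resolve_right hpi

/-- Since `x + iy = (ξ + iη)²/2`, take `ξ + iη = ±√(2r) e^{iφ/2}` with the sign making `ξ ≥ 0`. -/
lemma exists_parabolic (r φ : ℝ) (hr : 0 < r) : ∃ ξ η : ℝ, 0 ≤ ξ ∧
    (ξ ^ 2 - η ^ 2) / 2 = r * Real.cos φ ∧ ξ * η = r * Real.sin φ := by
  have hs : √(2 * r) ^ 2 = 2 * r := Real.sq_sqrt (by positivity)
  have hc : Real.cos φ = Real.cos (φ / 2) ^ 2 - Real.sin (φ / 2) ^ 2 := by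
    rw [← Real.cos_two_mul', mul_div_cancel₀ _ two_ne_zero]
  have hn : Real.sin φ = 2 * Real.sin (φ / 2) * Real.cos (φ / 2) := by
    rw [← Real.sin_two_mul, mul_div_cancel₀ _ two_ne_zero]
  rcases le_total 0 (Real.cos (φ / 2)) with h | h
  · refine ⟨√(2 * r) * Real.cos (φ / 2), √(2 * r) * Real.sin (φ / 2), by positivity, ?_, ?_⟩
    · rw [hc]; linear_combination (Real.cos (φ / 2) ^ 2 - Real.sin (φ / 2) ^ 2) / 2 * hs
    · rw [hn]; linear_combination Real.sin (φ / 2) * Real.cos (φ / 2) * hs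
  · refine ⟨√(2 * r) * -Real.cos (φ / 2), √(2 * r) * -Real.sin (φ / 2),
      mul_nonneg (Real.sqrt_nonneg _) (neg_nonneg.2 h), ?_, ?_⟩
    · rw [hc]; linear_combination (Real.cos (φ / 2) ^ 2 - Real.sin (φ / 2) ^ 2) / 2 * hs
    · rw [hn]; linear_combination Real.sin (φ / 2) * Real.cos (φ / 2) * hs

/-- On the circle `r = 1/k` the difference of the two expansions is a Fourier series with sum zero,
whose coefficients are `W m - W' m` times a nonzero multiple of `J_{|m|}(1)`. -/
lemma IsPolarExpansion.unique {k : ℝ} (hk : 0 < k) {Ψ : ℝ → ℝ → ℂ} {W W' : ℤ → ℂ}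
    (h : IsPolarExpansion k Ψ W) (h' : IsPolarExpansion k Ψ W') : W = W' := by
  ext n
  have hr : 0 < 1 / k := by positivity
  have h0 := eq_zero_of_hasSum_exp_zero (d := fun m => (W m - W' m) *
    ((√k : ℂ) * (besselJ m.natAbs (k * (1 / k)) : ℂ) / (√(2 * Real.pi) : ℂ))) (fun φ hφ => ?_) n
  · rw [mul_one_div_cancel hk.ne'] at h0
    have h1 : (√k : ℂ) ≠ 0 := by exact_mod_cast (Real.sqrt_pos.2 hk).ne'
    have h2 : (√(2 * Real.pi) : ℂ) ≠ 0 := by exact_mod_cast (Real.sqrt_pos.2 Real.two_pi_pos).ne'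
    have h3 : (besselJ n.natAbs 1 : ℂ) ≠ 0 := by exact_mod_cast besselJ_one_ne_zero _
    exact sub_eq_zero.1 ((mul_eq_zero.1 h0).resolve_right (div_ne_zero (mul_ne_zero h1 h3) h2))
  · obtain ⟨ξ, η, hξ, hx, hy⟩ := exists_parabolic (1 / k) φ hr
    refine hasSum_of_eq ((h ξ η _ φ hξ hr hφ hx hy).sub (h' ξ η _ φ hξ hr hφ hx hy))
      (fun m => ?_) (sub_self _).symm
    unfold polarWave
    ring

/-! ### Existence of the expansions. -/

/-- Kummer's transformation replaces `v` by `u` in the second `₁F₁`, after which the product formula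
applies with `X = ikξ²`, `Y = -ikη²`. The angle enters through `cos θ = 1 - 2t` and `sin² θ = 4t(1 -
t)`. -/
lemma betaMean_planeWave {u v : ℂ} (hu : 0 < u.re) (hv : 0 < v.re) (k ξ η : ℝ) :
    (betaMean u v fun t => exp (-(I * k * ((ξ ^ 2 - η ^ 2) / 2) *
        Real.cos (Real.arccos (1 - 2 * t)))) *
      hyp0F1 (u + v) (-((k * (ξ * η) * Real.sin (Real.arccos (1 - 2 * t))) ^ 2 / 4))) =
    exp (-(I * k * (ξ ^ 2 + η ^ 2) / 2)) * hyp1F1 u (u + v) (I * k * ξ ^ 2) *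
      hyp1F1 v (u + v) (I * k * η ^ 2) := by
  rw [exp_mul_hyp1F1_neg hu hv (I * k * η ^ 2)]
  have h := betaMean_exp_mul_hyp0F1 hu hv (I * k * ξ ^ 2) (-(I * k * η ^ 2))
  trans exp (-(I * k * ((ξ ^ 2 - η ^ 2) / 2))) *
    (hyp1F1 u (u + v) (I * k * ξ ^ 2) * hyp1F1 u (u + v) (-(I * k * η ^ 2)))
  · rw [← h, ← betaMean_const_mul]
    refine betaMean_congr fun t ht => ?_
    have ht' : t ∈ Set.Icc (0 : ℝ) 1 := ⟨ht.1.le, ht.2.le⟩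
    have hsin : Real.sin (Real.arccos (1 - 2 * t)) ^ 2 = 4 * (t * (1 - t)) := by
      rw [Real.sin_sq, cos_arccos_one_sub_two_mul ht']; ring
    rw [cos_arccos_one_sub_two_mul ht', mul_pow, ← ofReal_pow (Real.sin _), hsin,
      ← mul_assoc (exp _) (exp _), ← exp_add]
    congr 2
    · push_cast; ring
    · push_cast
      linear_combination -(k : ℂ) ^ 2 * ξ ^ 2 * η ^ 2 * t * (1 - t) * I_sq
  · rw [show -(I * k * (ξ ^ 2 + η ^ 2) / 2) =
      -(I * k * ((ξ ^ 2 - η ^ 2) / 2)) - I * (k : ℂ) * η ^ 2 by ring, exp_sub]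
    field_simp [exp_ne_zero]

lemma ofReal_sqrt_const {k : ℝ} (hk : 0 < k) :
    (√k : ℂ) / (√(2 * Real.pi) : ℂ) / (√(Real.pi ^ 3 * k) : ℂ) = 1 / (√2 * Real.pi ^ 2) := by
  have hpi := Real.pi_pos
  have h1 : √(Real.pi ^ 3 * k) = Real.pi * √Real.pi * √k := by
    rw [Real.sqrt_mul (by positivity), show Real.pi ^ 3 = Real.pi ^ 2 * Real.pi by ring,
      Real.sqrt_mul (by positivity), Real.sqrt_sq hpi.le]
  have h2 : √(2 * Real.pi) = √2 * √Real.pi := Real.sqrt_mul (by norm_num) _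
  have h3 : √Real.pi * √Real.pi = Real.pi := Real.mul_self_sqrt hpi.le
  have h4 : √k ≠ 0 := (Real.sqrt_pos.2 hk).ne'
  have h5 : √Real.pi ≠ 0 := (Real.sqrt_pos.2 hpi).ne'
  have h : √k / √(2 * Real.pi) / √(Real.pi ^ 3 * k) = 1 / (√2 * Real.pi ^ 2) := by
    rw [h1, h2]
    field_simp
    rw [pow_two √Real.pi, h3]
  exact_mod_cast h

/-- The coefficients of the even parabolic wave function. -/
def coeffEven (k β : ℝ) (m : ℤ) : ℂ :=
  (-I) ^ m.natAbs / (2 * (√(Real.pi ^ 3 * k) : ℂ)) *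
    (‖Gamma (1 / 4 + I * β / (2 * k))‖ : ℂ) ^ 2 *
    hyp3F2 (-(m.natAbs : ℂ)) (m.natAbs : ℂ) (1 / 4 + I * β / (2 * k)) (1 / 2) (1 / 2) 1

/-- The coefficients of the odd parabolic wave function. -/
def coeffOdd (k β : ℝ) (m : ℤ) : ℂ :=
  2 * (m : ℂ) * ((-I) ^ m.natAbs / (√(Real.pi ^ 3 * k) : ℂ)) *
    (‖Gamma (3 / 4 + I * β / (2 * k))‖ : ℂ) ^ 2 *
    hyp3F2 (1 - (m.natAbs : ℂ)) (1 + (m.natAbs : ℂ)) (3 / 4 + I * β / (2 * k)) (3 / 2) (3 / 2) 1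

lemma I_mul_div_re (k β : ℝ) : (I * β / (2 * k)).re = 0 := by
  rw [show I * (β : ℂ) / (2 * k) = ((β / (2 * k) : ℝ) : ℂ) * I by push_cast; ring, re_ofReal_mul]
  simp

lemma isPolarExpansion_coeffEven {k : ℝ} (hk : 0 < k) (β : ℝ) :
    IsPolarExpansion k (parabolicEven k β) (coeffEven k β) := by
  intro ξ η r φ _ _ _ hx hy
  have hu : 0 < (1 / 4 + I * β / (2 * k)).re := by rw [add_re, I_mul_div_re]; norm_num
  have hv : 0 < (1 / 4 - I * β / (2 * k)).re := by rw [sub_re, I_mul_div_re]; norm_num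
  have huv : 1 / 4 + I * β / (2 * k) + (1 / 4 - I * β / (2 * k)) = (1 / 2 : ℂ) := by ring
  have hpw := betaMean_planeWave hu hv k ξ η
  have h3F2 := hyp3F2_eq_betaMean_cos hu hv huv
  rw [huv] at hpw
  unfold parabolicEven coeffEven polarWave normEven
  generalize 1 / 4 + I * β / (2 * k) = u at *
  generalize 1 / 4 - I * β / (2 * k) = v at *
  -- As `|cos mθ| ≤ 1`, the Jacobi–Anger series at `φ` itself dominates, uniformly in `t`.
  have hM := (hasSum_jacobiAnger (k * r) φ).summable.norm
  have h := hasSum_betaMean hu hv (F := fun (m : ℤ) t => (-I) ^ m.natAbs *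
    (besselJ m.natAbs (k * r) : ℂ) * exp (m * (I * φ)) *
      (Real.cos (m * Real.arccos (1 - 2 * t)) : ℂ)) (fun m => by fun_prop) hM (fun m t _ => ?_)
      (fun t _ => hasSum_jacobiAnger_cos (k * r) φ (Real.arccos (1 - 2 * t)))
  · have hx' : ((ξ : ℂ) ^ 2 - η ^ 2) / 2 = r * Real.cos φ := by exact_mod_cast hx
    have hy' : (ξ : ℂ) * η = r * Real.sin φ := by exact_mod_cast hy
    have hval : (betaMean u v fun t => exp (-(I * ((k * r : ℝ) : ℂ) * Real.cos φ *
        Real.cos (Real.arccos (1 - 2 * t)))) *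
        cos (((k * r : ℝ) : ℂ) * Real.sin φ * Real.sin (Real.arccos (1 - 2 * t)))) =
        exp (-(I * k * (ξ ^ 2 + η ^ 2) / 2)) * hyp1F1 u (1 / 2) (I * k * ξ ^ 2) *
          hyp1F1 v (1 / 2) (I * k * η ^ 2) := by
      rw [← hpw]
      refine betaMean_congr fun t _ => ?_
      rw [cos_eq_hyp0F1, hx', hy']
      push_cast
      ring_nf
    rw [hval] at h
    refine hasSum_of_eq (h.mul_left ((‖Gamma u‖ : ℂ) ^ 2 / 2 *
      ((√k : ℂ) / (√(2 * Real.pi) : ℂ) / (√(Real.pi ^ 3 * k) : ℂ)))) (fun m => ?_) ?_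
    · rw [betaMean_const_mul, ← h3F2]
      ring_nf
    · rw [ofReal_sqrt_const hk]
      push_cast
      ring
  · rw [norm_mul _ (Real.cos _ : ℂ), norm_real]
    exact mul_le_of_le_one_right (norm_nonneg _) (Real.abs_cos_le_one _)

/-- Same mechanism as in the even case, with the sine series divided by `sin θ`: writing the sine as
its argument times a `₀F₁` with parameter `3/2` then releases the factor `kξη`. -/
lemma isPolarExpansion_coeffOdd {k : ℝ} (hk : 0 < k) (β : ℝ) :
    IsPolarExpansion k (parabolicOdd k β) (coeffOdd k β) := by
  intro ξ η r φ _ _ _ hx hy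
  have hu : 0 < (3 / 4 + I * β / (2 * k)).re := by rw [add_re, I_mul_div_re]; norm_num
  have hv : 0 < (3 / 4 - I * β / (2 * k)).re := by rw [sub_re, I_mul_div_re]; norm_num
  have huv : 3 / 4 + I * β / (2 * k) + (3 / 4 - I * β / (2 * k)) = (3 / 2 : ℂ) := by ring
  have hpw := betaMean_planeWave hu hv k ξ η
  have h3F2 := hyp3F2_eq_betaMean_sin hu hv huv
  rw [huv] at hpw
  unfold parabolicOdd coeffOdd polarWave normOdd
  generalize 3 / 4 + I * β / (2 * k) = u at *
  generalize 3 / 4 - I * β / (2 * k) = v at *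
  have h := hasSum_betaMean hu hv (F := fun (m : ℤ) t => (-I) ^ m.natAbs *
    (besselJ m.natAbs (k * r) : ℂ) * exp (m * (I * φ)) *
      ((Real.sin (m * Real.arccos (1 - 2 * t)) / Real.sin (Real.arccos (1 - 2 * t)) : ℝ) : ℂ))
      (fun m => by fun_prop) (summable_mul_besselJ (k * r)) (fun m t _ => ?_)
      (fun t _ => hasSum_of_eq ((hasSum_jacobiAnger_sin (k * r) φ
        (Real.arccos (1 - 2 * t))).div_const (Real.sin (Real.arccos (1 - 2 * t)) : ℂ))
        (fun m => by push_cast; ring) rfl)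
  · have hx' : ((ξ : ℂ) ^ 2 - η ^ 2) / 2 = r * Real.cos φ := by exact_mod_cast hx
    have hy' : (ξ : ℂ) * η = r * Real.sin φ := by exact_mod_cast hy
    have hval : (betaMean u v fun t => exp (-(I * ((k * r : ℝ) : ℂ) * Real.cos φ *
        Real.cos (Real.arccos (1 - 2 * t)))) *
        sin (((k * r : ℝ) : ℂ) * Real.sin φ * Real.sin (Real.arccos (1 - 2 * t))) /
          (Real.sin (Real.arccos (1 - 2 * t)) : ℂ)) =
        k * (ξ * η) * (exp (-(I * k * (ξ ^ 2 + η ^ 2) / 2)) * hyp1F1 u (3 / 2) (I * k * ξ ^ 2) *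
          hyp1F1 v (3 / 2) (I * k * η ^ 2)) := by
      rw [← hpw, ← betaMean_const_mul]
      refine betaMean_congr fun t ht => ?_
      have hs : (Real.sin (Real.arccos (1 - 2 * t)) : ℂ) ≠ 0 := by
        exact_mod_cast sin_arccos_one_sub_two_mul_ne_zero ht
      rw [sin_eq_mul_hyp0F1, div_eq_iff hs, hx', hy']
      push_cast
      ring_nf
    rw [hval] at h
    refine hasSum_of_eq (h.mul_left (2 * (‖Gamma u‖ : ℂ) ^ 2 *
      ((√k : ℂ) / (√(2 * Real.pi) : ℂ) / (√(Real.pi ^ 3 * k) : ℂ)))) (fun m => ?_) ?_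
    · rw [betaMean_const_mul, ← h3F2]
      ring_nf
    · rw [ofReal_sqrt_const hk]
      have h2 : (√2 : ℂ) * √2 = 2 := by exact_mod_cast Real.mul_self_sqrt zero_le_two
      have h0 : (√2 : ℂ) ≠ 0 := by intro h0; simp [h0] at h2
      have hs : (√2 : ℂ) = 2 / √2 := by rw [eq_div_iff h0, h2]
      push_cast
      nth_rewrite 1 [hs]
      ring
  · rw [norm_mul, norm_mul, norm_mul, norm_pow, norm_neg, norm_I, one_pow, one_mul, norm_real,
      norm_real, show (m : ℂ) * (I * φ) = ((m * φ : ℝ) : ℂ) * I by push_cast; ring,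
      norm_exp_ofReal_mul_I, mul_one, mul_comm, Real.norm_eq_abs, Real.norm_eq_abs, abs_div]
    gcongr
    -- The bound is also needed at the endpoints, where `sin θ = 0` and the quotient is 0 by
    -- convention; this form of the division lemma allows a zero denominator.
    exact div_le_of_le_mul₀ (abs_nonneg _) (abs_nonneg _) (abs_sin_int_mul_le _ _)

/-! ### Rewriting the coefficients with continuous Hahn polynomials. -/

lemma Gamma_one_half_add_nat_sq (n : ℕ) :
    Gamma (1 / 2 + n) ^ 2 = poch (1 / 2) n ^ 2 * Real.pi := by
  have h : Gamma (1 / 2) ^ 2 = Real.pi := by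
    have h1 : Gamma (1 / 2 : ℂ) = ((√Real.pi : ℝ) : ℂ) := by
      rw [← Real.Gamma_one_half_eq, ← Gamma_ofReal]; norm_num
    rw [h1, ← ofReal_pow, Real.sq_sqrt Real.pi_pos.le]
  rw [Gamma_add_natCast (by norm_num), mul_pow, h]

lemma sqrt_pi_pow_three_mul (k : ℝ) : √(Real.pi ^ 3 * k) = Real.pi * √(Real.pi * k) := by
  rw [show Real.pi ^ 3 * k = Real.pi ^ 2 * (Real.pi * k) by ring,
    Real.sqrt_mul (by positivity), Real.sqrt_sq Real.pi_pos.le]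

/-- The two `₃F₂` already agree. In the constants, `Γ(1/2 + n)² = π (1/2)_n²` cancels the Pochhammer
symbols of the Hahn prefactor, and `(-i)^n = (-1)^n i^n`. -/
lemma coeffEven_eq_continuousHahn {k : ℝ} (hk : 0 < k) (β : ℝ) (m : ℤ) :
    coeffEven k β m = (-1) ^ m.natAbs * (m.natAbs.factorial : ℂ) / (2 * (√(Real.pi * k) : ℂ)) *
      ((‖Gamma (1 / 4 + I * β / (2 * k))‖ : ℂ) ^ 2 / Gamma (1 / 2 + m.natAbs) ^ 2) *
      continuousHahn m.natAbs (β / (2 * k)) (1 / 4) (1 / 4) (1 / 4) (1 / 4) := by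
  unfold coeffEven continuousHahn
  generalize m.natAbs = n
  rw [Gamma_one_half_add_nat_sq, sqrt_pi_pow_three_mul, show (1 / 4 + 1 / 4 : ℂ) = 1 / 2 by norm_num,
    show (n + 1 / 4 + 1 / 4 + 1 / 4 + 1 / 4 - 1 : ℂ) = n by ring, ← mul_div_assoc I (β : ℂ),
    neg_pow I]
  have h1 : poch (1 / 2) n ≠ 0 := poch_ne_zero (by norm_num) n
  have h2 : (n.factorial : ℂ) ≠ 0 := by exact_mod_cast n.factorial_ne_zero
  have h3 : (Real.pi : ℂ) ≠ 0 := by exact_mod_cast Real.pi_ne_zero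
  have h4 : (√(Real.pi * k) : ℂ) ≠ 0 := by
    exact_mod_cast (Real.sqrt_pos.2 (mul_pos Real.pi_pos hk)).ne'
  push_cast
  field_simp

lemma poch_succ_left (a : ℂ) (n : ℕ) : poch a (n + 1) = a * poch (a + 1) n := by
  rw [poch_eq_prod, poch_eq_prod, prod_range_succ']
  push_cast
  simp only [add_zero, mul_comm a, add_assoc, add_comm (1 : ℂ)]

lemma coeffOdd_eq_continuousHahn {k : ℝ} (hk : 0 < k) (β : ℝ) (m : ℤ) :
    coeffOdd k β m = I * (m.sign : ℂ) *
      ((-1) ^ m.natAbs * (m.natAbs.factorial : ℂ) / (2 * (√(Real.pi * k) : ℂ))) *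
      ((‖Gamma (3 / 4 + I * β / (2 * k))‖ : ℂ) ^ 2 / Gamma (1 / 2 + m.natAbs) ^ 2) *
      continuousHahn (m.natAbs - 1) (β / (2 * k)) (3 / 4) (3 / 4) (3 / 4) (3 / 4) := by
  rcases eq_or_ne m 0 with rfl | hm
  -- Here the degree `m.natAbs - 1` truncates to 0, harmlessly: the factors `m` and `m.sign` vanish.
  · simp [coeffOdd]
  have hms : (m : ℂ) = m.sign * m.natAbs := by
    rw [← Int.cast_natCast m.natAbs, ← Int.cast_mul, Int.sign_mul_natAbs]
  unfold coeffOdd continuousHahn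
  rw [hms]
  obtain ⟨n, hn⟩ : ∃ n, m.natAbs = n + 1 := ⟨m.natAbs - 1, by omega⟩
  -- With `n = |m| - 1`, the shift `(1/2)_{n+1} = (1/2)(3/2)_n` matches the Hahn prefactor, and the
  -- extra `i` in front comes from `i^{n+1} = i^n · i`.
  rw [hn, Gamma_one_half_add_nat_sq, sqrt_pi_pow_three_mul, poch_succ_left, Nat.add_sub_cancel,
    show (1 / 2 + 1 : ℂ) = 3 / 2 by norm_num, show (3 / 4 + 3 / 4 : ℂ) = 3 / 2 by norm_num,
    show (n + 3 / 4 + 3 / 4 + 3 / 4 + 3 / 4 - 1 : ℂ) = 1 + ((n + 1 : ℕ) : ℂ) by push_cast; ring,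
    show 1 - ((n + 1 : ℕ) : ℂ) = -n by push_cast; ring, ← mul_div_assoc I (β : ℂ),
    neg_pow I, pow_succ I, Nat.factorial_succ]
  have h1 : poch (3 / 2) n ≠ 0 := poch_ne_zero (by norm_num) n
  have h2 : (n.factorial : ℂ) ≠ 0 := by exact_mod_cast n.factorial_ne_zero
  have h3 : (Real.pi : ℂ) ≠ 0 := by exact_mod_cast Real.pi_ne_zero
  have h4 : (√(Real.pi * k) : ℂ) ≠ 0 := by
    exact_mod_cast (Real.sqrt_pos.2 (mul_pos Real.pi_pos hk)).ne'
  push_cast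
  field_simp

end ParabolicPolar

end

/-- The even and the odd parabolic wave functions have unique expansions over the polar basis, and
the coefficients are given by the `₃F₂` formulas and by the continuous Hahn polynomials. For
`m = 0` the odd coefficient vanishes, through the factor `m`, respectively `sign m`. -/
theorem mainTheorem1 (k β : ℝ) (hk : 0 < k) :
    ((∃! W : ℤ → ℂ, ParabolicPolar.IsPolarExpansion k (ParabolicPolar.parabolicEven k β) W) ∧
      ∀ W : ℤ → ℂ, ParabolicPolar.IsPolarExpansion k (ParabolicPolar.parabolicEven k β) W →
        ∀ m : ℤ,
          W m = (-Complex.I) ^ m.natAbs / (2 * (√(Real.pi ^ 3 * k) : ℂ)) *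
              (‖Complex.Gamma (1 / 4 + Complex.I * β / (2 * k))‖ : ℂ) ^ 2 *
              ParabolicPolar.hyp3F2 (-(m.natAbs : ℂ)) (m.natAbs : ℂ)
                (1 / 4 + Complex.I * β / (2 * k)) (1 / 2) (1 / 2) 1 ∧
          W m = (-1) ^ m.natAbs * (m.natAbs.factorial : ℂ) / (2 * (√(Real.pi * k) : ℂ)) *
              ((‖Complex.Gamma (1 / 4 + Complex.I * β / (2 * k))‖ : ℂ) ^ 2 /
                Complex.Gamma (1 / 2 + m.natAbs) ^ 2) *
              ParabolicPolar.continuousHahn m.natAbs (β / (2 * k))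
                (1 / 4) (1 / 4) (1 / 4) (1 / 4)) ∧
    ((∃! W : ℤ → ℂ, ParabolicPolar.IsPolarExpansion k (ParabolicPolar.parabolicOdd k β) W) ∧
      ∀ W : ℤ → ℂ, ParabolicPolar.IsPolarExpansion k (ParabolicPolar.parabolicOdd k β) W →
        ∀ m : ℤ,
          W m = 2 * (m : ℂ) * ((-Complex.I) ^ m.natAbs / (√(Real.pi ^ 3 * k) : ℂ)) *
              (‖Complex.Gamma (3 / 4 + Complex.I * β / (2 * k))‖ : ℂ) ^ 2 *
              ParabolicPolar.hyp3F2 (1 - (m.natAbs : ℂ)) (1 + (m.natAbs : ℂ))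
                (3 / 4 + Complex.I * β / (2 * k)) (3 / 2) (3 / 2) 1 ∧
          W m = Complex.I * (m.sign : ℂ) *
              ((-1) ^ m.natAbs * (m.natAbs.factorial : ℂ) / (2 * (√(Real.pi * k) : ℂ))) *
              ((‖Complex.Gamma (3 / 4 + Complex.I * β / (2 * k))‖ : ℂ) ^ 2 /
                Complex.Gamma (1 / 2 + m.natAbs) ^ 2) *
              ParabolicPolar.continuousHahn (m.natAbs - 1) (β / (2 * k))
                (3 / 4) (3 / 4) (3 / 4) (3 / 4)) := by
  have he : ParabolicPolar.IsPolarExpansion k (ParabolicPolar.parabolicEven k β) _ :=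
    ParabolicPolar.isPolarExpansion_coeffEven hk β
  have ho : ParabolicPolar.IsPolarExpansion k (ParabolicPolar.parabolicOdd k β) _ :=
    ParabolicPolar.isPolarExpansion_coeffOdd hk β
  refine ⟨⟨⟨_, he, fun W hW => hW.unique hk he⟩, fun W hW m => ?_⟩,
    ⟨_, ho, fun W hW => hW.unique hk ho⟩, fun W hW m => ?_⟩
  · rw [hW.unique hk he]
    exact ⟨rfl, ParabolicPolar.coeffEven_eq_continuousHahn hk β m⟩
  · rw [hW.unique hk ho]
    exact ⟨rfl, ParabolicPolar.coeffOdd_eq_continuousHahn hk β m⟩
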